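/- Let $\Delta=\{z\in\mathbb{C}:|z|<1\}$. A one-parameter continuous semigroup on $\Delta$ is a family $\{F_t\}_{t\ge 0}$ of holomorphic self-mappings of $\Delta$ such that $F_t\circ F_s=F_{t+s}$ for all $t,s\ge 0$ and $\lim_{t\to 0^+}F_t(z)=z$ for all $z\in\Delta$; its generator is the function $f(z)=\lim_{t\to 0^+}\frac{z-F_t(z)}{t}$, $z\in\Delta$. It is called a group of automorphisms if every $F_t$ is an automorphism of $\Delta$, and a group of elliptic automorphisms if, in addition, every $F_t$ has a fixed point in $\Delta$; it is nontrivial if some $F_t$ is not the identity. Two semigroups $\{F_t\}_{t\ge0}$ and $\{G_t\}_{t\ge0}$ commute if $F_t\circ G_s=G_s\circ F_t$ for all $s,t\ge 0$. **Theorem.** Let $S_1=\{F_t\}_{t\ge 0}$ and $S_2=\{G_t\}_{t\ge 0}$ be one-parameter continuous semigroups on $\Delta$, let $f$ be the generator of $S_1$, and let $F_1\circ G_1=G_1\circ F_1$. Suppose that $f(\tau)=0$ for some $\tau\in\Delta$. (i) If neither $S_1$ nor $S_2$ is a group of automorphisms of $\Delta$, then $S_1$ and $S_2$ commute. (ii)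 If $S_1$ is a nontrivial group of elliptic automorphisms of $\Delta$, then $S_1$ and $S_2$ commute if and only if there is $a\in\mathbb{C}$ such that $$G_t(z)=m_\tau\bigl(e^{-at}\,m_\tau(z)\bigr)\qquad\text{for all } t\ge 0,\ z\in\Delta,$$ where $m_\tau(z)=\dfrac{\tau-z}{1-\overline{\tau}z}$. -/

import Mathlib

open Set Filter Topology

namespace DiskSemigroup

/-- The open unit disk of the complex plane. -/
abbrev disk : Set ℂ := Metric.ball (0 : ℂ) 1

/-- `F` restricts to a holomorphic self-mapping of the unit disk (its values outside are irrelevant). -/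
def IsHolSelfMap (F : ℂ → ℂ) : Prop :=
  DifferentiableOn ℂ F disk ∧ MapsTo F disk disk

/-- A one-parameter continuous semigroup of holomorphic self-mappings of the disk.
Only the parameters `t ≥ 0` and the points of the disk matter. -/
structure IsSemigroup (F : ℝ → ℂ → ℂ) : Prop where
  isHolSelfMap : ∀ t : ℝ, 0 ≤ t → IsHolSelfMap (F t)
  comp_eq : ∀ t s : ℝ, 0 ≤ t → 0 ≤ s → ∀ z ∈ disk, F t (F s z) = F (t + s) z
  tendsto_id : ∀ z ∈ disk, Tendsto (fun t : ℝ => F t z) (𝓝[>] 0) (𝓝 z)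

/-- `f` is the infinitesimal generator of the family `F`:
`f z = lim_{t → 0+} (z - F t z) / t` for every `z` in the disk. -/
def IsGenerator (f : ℂ → ℂ) (F : ℝ → ℂ → ℂ) : Prop :=
  ∀ z ∈ disk, Tendsto (fun t : ℝ => (z - F t z) / (t : ℂ)) (𝓝[>] 0) (𝓝 (f z))

/-- `F` restricts to a (holomorphic) automorphism of the disk. -/
def IsAutomorphism (F : ℂ → ℂ) : Prop :=
  IsHolSelfMap F ∧ ∃ H : ℂ → ℂ, IsHolSelfMap H ∧ InvOn H F disk disk

/-- All elements of the semigroup are automorphisms of the disk, that is, the semigroup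
extends to a group of automorphisms. -/
def IsAutomorphismGroup (F : ℝ → ℂ → ℂ) : Prop :=
  ∀ t : ℝ, 0 ≤ t → IsAutomorphism (F t)

/-- A group of elliptic automorphisms: every element is an automorphism of the disk with a fixed
point in the disk (the identity, which every group contains, is allowed as an element). -/
def IsEllipticGroup (F : ℝ → ℂ → ℂ) : Prop :=
  IsAutomorphismGroup F ∧ ∀ t : ℝ, 0 ≤ t → ∃ z ∈ disk, F t z = z

/-- The semigroup does not consist of the identity alone. -/
def IsNontrivial (F : ℝ → ℂ → ℂ) : Prop :=
  ∃ t : ℝ, 0 ≤ t ∧ ∃ z ∈ disk, F t z ≠ z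

/-- Two self-mappings of the disk commute. -/
def MapsCommute (F G : ℂ → ℂ) : Prop :=
  ∀ z ∈ disk, F (G z) = G (F z)

/-- Two semigroups commute: all their elements do. -/
def SemigroupsCommute (F G : ℝ → ℂ → ℂ) : Prop :=
  ∀ t s : ℝ, 0 ≤ t → 0 ≤ s → MapsCommute (F t) (G s)

/-- The Möbius involution `m_τ(z) = (τ - z) / (1 - conj τ * z)`. -/
noncomputable def mobius (τ z : ℂ) : ℂ :=
  (τ - z) / (1 - (starRingEnd ℂ) τ * z)

end DiskSemigroup

/-! A zero of `f` is fixed by every `F t`. In the coordinate `m_τ` this point is the origin, and the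
Schwarz lemma gives multipliers `λ_t = F_t'(τ)` with `|λ_t| ≤ 1`, equality meaning that `F t` is a
rotation.

The core is `eventuallyEq_or_resonance`. If `φ` and `ψ` commute with `F`, have equal derivatives at
`τ` and `φ - ψ ~ c (z - τ)^n`, then the leading terms of `F ∘ φ - F ∘ ψ = φ ∘ F - ψ ∘ F` give `λ c =
λ^n c`.

In (i), `0 < |λ_1| < 1` excludes resonance, so `F t ∘ H = H ∘ F t` for any `H` fixing `τ` and
commuting with `F 1`; this is used once for each semigroup. In (ii), resonance for all `t` with a
single `n` would make every `λ_t = 1`, so each `G s` equals the `m_τ`-linear map with its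
multiplier, and these multipliers are exponential in `s`. -/

namespace DiskSemigroup

/-! ### The disk and its Möbius involutions. -/

theorem isOpen_disk : IsOpen disk := Metric.isOpen_ball

theorem norm_lt_one_of_mem {z : ℂ} (hz : z ∈ disk) : ‖z‖ < 1 := by simpa using hz

theorem zero_mem_disk : (0 : ℂ) ∈ disk := by simp

theorem mul_mem_disk {c z : ℂ} (hc : ‖c‖ ≤ 1) (hz : z ∈ disk) : c * z ∈ disk := by
  have := norm_lt_one_of_mem hz
  rw [mem_ball_zero_iff, norm_mul]
  nlinarith [norm_nonneg z]

theorem one_sub_conj_mul_ne_zero {τ z : ℂ} (hτ : τ ∈ disk) (hz : z ∈ disk) :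
    1 - (starRingEnd ℂ) τ * z ≠ 0 := by
  intro h
  have h1 : ‖(starRingEnd ℂ) τ * z‖ = 1 := by rw [← sub_eq_zero.1 h]; simp
  rw [norm_mul, RCLike.norm_conj] at h1
  nlinarith [norm_nonneg z, norm_nonneg τ, norm_lt_one_of_mem hτ, norm_lt_one_of_mem hz]

theorem one_sub_conj_mul_self_ne_zero {τ : ℂ} (hτ : τ ∈ disk) : 1 - τ * (starRingEnd ℂ) τ ≠ 0 := by
  rw [mul_comm]; exact one_sub_conj_mul_ne_zero hτ hτ

theorem mobius_mem_disk {τ z : ℂ} (hτ : τ ∈ disk) (hz : z ∈ disk) : mobius τ z ∈ disk := by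
  rw [mem_ball_zero_iff, mobius, norm_div,
    div_lt_one (norm_pos_iff.2 (one_sub_conj_mul_ne_zero hτ hz))]
  refine lt_of_pow_lt_pow_left₀ 2 (norm_nonneg _) ?_
  have h1 := norm_lt_one_of_mem hτ
  have h2 := norm_lt_one_of_mem hz
  have h3 : ‖τ‖ ^ 2 < 1 := by nlinarith [norm_nonneg τ]
  have h4 : ‖z‖ ^ 2 < 1 := by nlinarith [norm_nonneg z]
  rw [← Complex.normSq_eq_norm_sq, Complex.normSq_apply] at h3 h4 ⊢
  rw [← Complex.normSq_eq_norm_sq, Complex.normSq_apply]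
  simp only [Complex.sub_re, Complex.sub_im, Complex.mul_re, Complex.mul_im, Complex.conj_re,
    Complex.conj_im, Complex.one_re, Complex.one_im]
  -- `|1 - conj τ * z|² - |τ - z|² = (1 - |τ|²)(1 - |z|²)`.
  nlinarith [mul_pos (sub_pos.2 h3) (sub_pos.2 h4)]

theorem mobius_mobius {τ z : ℂ} (hτ : τ ∈ disk) (hz : z ∈ disk) : mobius τ (mobius τ z) = z := by
  have h1 := one_sub_conj_mul_ne_zero hτ hz
  have h2 := one_sub_conj_mul_ne_zero hτ (mobius_mem_disk hτ hz)
  have e : mobius τ z * (1 - (starRingEnd ℂ) τ * z) = τ - z := div_mul_cancel₀ _ h1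
  rw [mobius, div_eq_iff h2]
  refine mul_right_cancel₀ h1 ?_
  linear_combination (z * (starRingEnd ℂ) τ - 1) * e

@[simp] theorem mobius_self (τ : ℂ) : mobius τ τ = 0 := by simp [mobius]

@[simp] theorem mobius_zero (τ : ℂ) : mobius τ 0 = τ := by simp [mobius]

theorem mobius_ne_zero {τ z : ℂ} (hτ : τ ∈ disk) (hz : z ∈ disk) (h : z ≠ τ) : mobius τ z ≠ 0 :=
  div_ne_zero (sub_ne_zero.2 h.symm) (one_sub_conj_mul_ne_zero hτ hz)

theorem hasDerivAt_mobius {τ z : ℂ} (hτ : τ ∈ disk) (hz : z ∈ disk) :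
    HasDerivAt (mobius τ) ((τ * (starRingEnd ℂ) τ - 1) / (1 - (starRingEnd ℂ) τ * z) ^ 2) z := by
  have h := ((hasDerivAt_id z).const_sub τ).div
    (((hasDerivAt_id z).const_mul ((starRingEnd ℂ) τ)).const_sub 1) (one_sub_conj_mul_ne_zero hτ hz)
  refine h.congr_deriv ?_
  simp only [id]
  congr 1
  ring

theorem hasDerivAt_mobius_zero {τ : ℂ} (hτ : τ ∈ disk) :
    HasDerivAt (mobius τ) (τ * (starRingEnd ℂ) τ - 1) 0 := by
  simpa using hasDerivAt_mobius hτ zero_mem_disk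

theorem hasDerivAt_mobius_self {τ : ℂ} (hτ : τ ∈ disk) :
    HasDerivAt (mobius τ) (τ * (starRingEnd ℂ) τ - 1)⁻¹ τ := by
  refine (hasDerivAt_mobius hτ hτ).congr_deriv ?_
  have := one_sub_conj_mul_self_ne_zero hτ
  have h' : τ * (starRingEnd ℂ) τ - 1 ≠ 0 := by rwa [← neg_sub, neg_ne_zero]
  rw [mul_comm ((starRingEnd ℂ) τ), ← neg_sub 1 (τ * (starRingEnd ℂ) τ)]
  field_simp

theorem IsHolSelfMap.mobius {τ : ℂ} (hτ : τ ∈ disk) : IsHolSelfMap (mobius τ) :=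
  ⟨fun _ hz => (hasDerivAt_mobius hτ hz).differentiableAt.differentiableWithinAt,
    fun _ hz => mobius_mem_disk hτ hz⟩

theorem IsHolSelfMap.comp {F G : ℂ → ℂ} (hF : IsHolSelfMap F) (hG : IsHolSelfMap G) :
    IsHolSelfMap (F ∘ G) :=
  ⟨hF.1.comp hG.1 hG.2, hF.2.comp hG.2⟩

theorem IsHolSelfMap.mul_left {c : ℂ} (hc : ‖c‖ ≤ 1) : IsHolSelfMap (fun z => c * z) :=
  ⟨by fun_prop, fun _ hz => mul_mem_disk hc hz⟩

theorem IsHolSelfMap.analyticAt {F : ℂ → ℂ} (hF : IsHolSelfMap F) {z : ℂ} (hz : z ∈ disk) :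
    AnalyticAt ℂ F z :=
  hF.1.analyticAt (isOpen_disk.mem_nhds hz)

theorem IsHolSelfMap.hasDerivAt {F : ℂ → ℂ} (hF : IsHolSelfMap F) {z : ℂ} (hz : z ∈ disk) :
    HasDerivAt F (deriv F z) z :=
  (hF.analyticAt hz).differentiableAt.hasDerivAt

theorem IsHolSelfMap.eqOn_of_eventuallyEq {F G : ℂ → ℂ} (hF : IsHolSelfMap F)
    (hG : IsHolSelfMap G) {τ : ℂ} (hτ : τ ∈ disk) (h : F =ᶠ[𝓝 τ] G) : EqOn F G disk :=
  AnalyticOnNhd.eqOn_of_preconnected_of_eventuallyEq (fun _ hz => hF.analyticAt hz)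
    (fun _ hz => hG.analyticAt hz) (convex_ball (0 : ℂ) 1).isPreconnected hτ h

/-- The map `w ↦ m_τ (F (m_τ w))`, which fixes the origin when `F` fixes `τ`. -/
noncomputable def recenter (τ : ℂ) (F : ℂ → ℂ) : ℂ → ℂ := mobius τ ∘ F ∘ mobius τ

/-! ### The Schwarz lemma at an interior fixed point. -/

section Schwarz

variable {F : ℂ → ℂ} {τ : ℂ}

theorem IsHolSelfMap.recenter (hF : IsHolSelfMap F) (hτ : τ ∈ disk) :
    IsHolSelfMap (recenter τ F) :=
  (IsHolSelfMap.mobius hτ).comp (hF.comp (IsHolSelfMap.mobius hτ))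

theorem recenter_zero (h : F τ = τ) : recenter τ F 0 = 0 := by simp [recenter, h]

theorem eq_mobius_recenter (hF : IsHolSelfMap F) (hτ : τ ∈ disk) {z : ℂ} (hz : z ∈ disk) :
    F z = mobius τ (recenter τ F (mobius τ z)) := by
  simp only [recenter, Function.comp_apply]
  rw [mobius_mobius hτ hz, mobius_mobius hτ (hF.2 hz)]

/-- The involution `m_τ` swaps `0` and `τ`, so its derivatives there are reciprocal and cancel. -/
theorem hasDerivAt_recenter (hF : IsHolSelfMap F) (hτ : τ ∈ disk) (h : F τ = τ) :
    HasDerivAt (recenter τ F) (deriv F τ) 0 := by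
  have hd : HasDerivAt F (deriv F τ) (mobius τ 0) := by simpa using hF.hasDerivAt hτ
  have hm : HasDerivAt (mobius τ) (τ * (starRingEnd ℂ) τ - 1)⁻¹ ((F ∘ mobius τ) 0) := by
    simpa [h] using hasDerivAt_mobius_self hτ
  refine (hm.comp 0 (hd.comp 0 (hasDerivAt_mobius_zero hτ))).congr_deriv ?_
  have := one_sub_conj_mul_self_ne_zero hτ
  have h' : τ * (starRingEnd ℂ) τ - 1 ≠ 0 := by rwa [← neg_sub, neg_ne_zero]
  field_simp

theorem IsHolSelfMap.mapsTo_closedBall {g : ℂ → ℂ} (hg : IsHolSelfMap g) (h0 : g 0 = 0) :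
    MapsTo g disk (Metric.closedBall (g 0) 1) := fun _ hz => by
  rw [h0]; exact Metric.ball_subset_closedBall (hg.2 hz)

theorem norm_deriv_le_one (hF : IsHolSelfMap F) (hτ : τ ∈ disk) (h : F τ = τ) :
    ‖deriv F τ‖ ≤ 1 := by
  rw [← (hasDerivAt_recenter hF hτ h).deriv]
  have hg := hF.recenter hτ
  exact Complex.norm_deriv_le_one_of_mapsTo_ball hg.1
    (hg.mapsTo_closedBall (recenter_zero h)) one_pos

/-- A self-map of the disk fixing `τ` for which equality holds in the Schwarz lemma is linear in
the coordinate `m_τ`. -/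
theorem eq_mobius_mul_of_norm_dslope (hF : IsHolSelfMap F) (hτ : τ ∈ disk) (h : F τ = τ) {w : ℂ}
    (hw : w ∈ disk) (hs : ‖dslope (recenter τ F) 0 w‖ = 1) {z : ℂ} (hz : z ∈ disk) :
    F z = mobius τ (dslope (recenter τ F) 0 w * mobius τ z) := by
  have hg := hF.recenter hτ
  have := Complex.affine_of_mapsTo_ball_of_norm_dslope_eq_div hg.1
    (hg.mapsTo_closedBall (recenter_zero h)) hw (by simpa using hs) (mobius_mem_disk hτ hz)
  rw [eq_mobius_recenter hF hτ hz, this, recenter_zero h]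
  simp [mul_comm]

theorem eq_mobius_mul_of_norm_deriv (hF : IsHolSelfMap F) (hτ : τ ∈ disk) (h : F τ = τ)
    (hd : ‖deriv F τ‖ = 1) {z : ℂ} (hz : z ∈ disk) :
    F z = mobius τ (deriv F τ * mobius τ z) := by
  have hs : dslope (recenter τ F) 0 0 = deriv F τ := by
    rw [dslope_same, (hasDerivAt_recenter hF hτ h).deriv]
  have := eq_mobius_mul_of_norm_dslope hF hτ h zero_mem_disk (by rw [hs, hd]) hz
  rwa [hs] at this

/-- A self-map of the disk with two fixed points is the identity. -/
theorem eq_id_of_fixed_ne (hF : IsHolSelfMap F) (hτ : τ ∈ disk) (h : F τ = τ) {w : ℂ}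
    (hw : w ∈ disk) (hwF : F w = w) (hne : w ≠ τ) {z : ℂ} (hz : z ∈ disk) : F z = z := by
  have h0 : mobius τ w ≠ 0 := mobius_ne_zero hτ hw hne
  -- A second fixed point gives equality in the Schwarz lemma, with factor `1`.
  have hs : dslope (recenter τ F) 0 (mobius τ w) = 1 := by
    rw [dslope_of_ne _ h0, slope_def_field, recenter_zero h]
    simp only [recenter, Function.comp_apply]
    rw [mobius_mobius hτ hw, hwF, sub_zero, div_self h0]
  have := eq_mobius_mul_of_norm_dslope hF hτ h (mobius_mem_disk hτ hw) (by simp [hs]) hz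
  rwa [hs, one_mul, mobius_mobius hτ hz] at this

theorem norm_mobius_le_sq_of_deriv_eq_zero (hF : IsHolSelfMap F) (hτ : τ ∈ disk) (h : F τ = τ)
    (hd : deriv F τ = 0) {z : ℂ} (hz : z ∈ disk) :
    ‖mobius τ (F z)‖ ≤ ‖mobius τ z‖ ^ 2 := by
  have hg := hF.recenter hτ
  have hg' := hasDerivAt_recenter hF hτ h
  rw [hd] at hg'
  have := Complex.dist_le_mul_div_pow_of_mapsTo_ball_of_isLittleO (n := 1) hg.1
    (hg.mapsTo_closedBall (recenter_zero h)) (by simpa using hg'.isLittleO.norm_right)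
    (mobius_mem_disk hτ hz)
  rw [recenter_zero h, dist_zero_right, dist_zero_right] at this
  simp only [recenter, Function.comp_apply, mobius_mobius hτ hz] at this
  simpa using this

theorem isAutomorphism_of_norm_deriv_eq_one (hF : IsHolSelfMap F) (hτ : τ ∈ disk) (h : F τ = τ)
    (hd : ‖deriv F τ‖ = 1) : IsAutomorphism F := by
  have hd' : ‖(deriv F τ)⁻¹‖ = 1 := by rw [norm_inv, hd, inv_one]
  have hd0 : deriv F τ ≠ 0 := by rw [← norm_pos_iff, hd]; exact one_pos
  refine ⟨hF, mobius τ ∘ (fun z => (deriv F τ)⁻¹ * z) ∘ mobius τ,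
    (IsHolSelfMap.mobius hτ).comp ((IsHolSelfMap.mul_left hd'.le).comp (IsHolSelfMap.mobius hτ)),
    fun z hz => ?_, fun z hz => ?_⟩
  · rw [eq_mobius_mul_of_norm_deriv hF hτ h hd hz]
    simp only [Function.comp_apply]
    rw [mobius_mobius hτ (mul_mem_disk hd.le (mobius_mem_disk hτ hz)), inv_mul_cancel_left₀ hd0,
      mobius_mobius hτ hz]
  · simp only [Function.comp_apply]
    have hm := mul_mem_disk hd'.le (mobius_mem_disk hτ hz)
    rw [eq_mobius_mul_of_norm_deriv hF hτ h hd (mobius_mem_disk hτ hm), mobius_mobius hτ hm,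
      mul_inv_cancel_left₀ hd0, mobius_mobius hτ hz]

theorem norm_deriv_eq_one_of_isAutomorphism (hF : IsAutomorphism F) (hτ : τ ∈ disk)
    (h : F τ = τ) : ‖deriv F τ‖ = 1 := by
  obtain ⟨hF, H, hH, hinv, -⟩ := hF
  have hHτ : H τ = τ := by simpa [h] using hinv hτ
  have hd : HasDerivAt (H ∘ F) (deriv H τ * deriv F τ) τ := by
    have : HasDerivAt H (deriv H τ) (F τ) := by rw [h]; exact hH.hasDerivAt hτ
    exact this.comp τ (hF.hasDerivAt hτ)
  have hid : H ∘ F =ᶠ[𝓝 τ] id :=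
    eventually_of_mem (isOpen_disk.mem_nhds hτ) fun z hz => hinv hz
  have h1 := hd.unique ((hasDerivAt_id τ).congr_of_eventuallyEq hid)
  have h2 : ‖deriv H τ‖ * ‖deriv F τ‖ = 1 := by rw [← norm_mul, h1, norm_one]
  have h3 := norm_deriv_le_one hF hτ h
  have h4 := norm_deriv_le_one hH hτ hHτ
  nlinarith [norm_nonneg (deriv F τ)]

/-- The Lipschitz constant does not depend on `F`, so it serves all elements of a semigroup at once.
-/
theorem dist_map_le (hF : IsHolSelfMap F) (hτ : τ ∈ disk) {z : ℂ}
    (hz : z ∈ Metric.ball τ (1 - ‖τ‖)) :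
    dist (F z) (F τ) ≤ 2 / (1 - ‖τ‖) * dist z τ := by
  have hsub : Metric.ball τ (1 - ‖τ‖) ⊆ disk :=
    Metric.ball_subset_ball' (by simp)
  refine Complex.dist_le_div_mul_dist_of_mapsTo_ball (hF.1.mono hsub) (fun w hw => ?_) hz
  rw [mem_closedBall_iff_norm]
  have h1 := norm_lt_one_of_mem (hF.2 (hsub hw))
  have h2 := norm_lt_one_of_mem (hF.2 hτ)
  linarith [norm_sub_le (F w) (F τ)]

end Schwarz

/-! ### Rigidity of commuting germs. -/

/-- Two germs at a common fixed point `τ` that commute with `F`, whose multiplier at `τ` is `lam`,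
and have equal derivatives there agree, unless `lam` satisfies a resonance `lam ^ n = lam`. -/
theorem eventuallyEq_or_resonance {φ ψ : ℂ → ℂ} {τ : ℂ} (hφ : AnalyticAt ℂ φ τ)
    (hψ : AnalyticAt ℂ ψ τ) (hφτ : φ τ = τ) (hψτ : ψ τ = τ) (hd : deriv φ τ = deriv ψ τ) :
    φ =ᶠ[𝓝 τ] ψ ∨ ∃ n : ℕ, 2 ≤ n ∧ ∀ F : ℂ → ℂ, AnalyticAt ℂ F τ → F τ = τ →
      F ∘ φ =ᶠ[𝓝 τ] φ ∘ F → F ∘ ψ =ᶠ[𝓝 τ] ψ ∘ F → deriv F τ ^ n = deriv F τ := by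
  by_cases h0 : ∀ᶠ z in 𝓝 τ, (φ - ψ) z = 0
  · exact .inl (h0.mono fun z hz => sub_eq_zero.1 hz)
  right
  -- `n` depends only on `φ` and `ψ`, hence serves every `F` simultaneously.
  obtain ⟨n, g, hg, hg0, hgeq⟩ := (hφ.sub hψ).exists_eventuallyEq_pow_smul_nonzero_iff.2 h0
  simp only [smul_eq_mul] at hgeq
  have hn : 2 ≤ n := by
    by_contra hn
    have hn' : n = 0 ∨ n = 1 := by omega
    rcases hn' with rfl | rfl
    · have := hgeq.self_of_nhds
      simp [hφτ, hψτ] at this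
      exact hg0 this.symm
    · have h1 : HasDerivAt (φ - ψ) 0 τ := by
        refine (hφ.differentiableAt.hasDerivAt.sub hψ.differentiableAt.hasDerivAt).congr_deriv ?_
        rw [hd, sub_self]
      have h2 : HasDerivAt (fun z => (z - τ) ^ 1 * g z) (g τ) τ := by
        have := (((hasDerivAt_id τ).sub_const τ).pow 1).mul hg.differentiableAt.hasDerivAt
        refine this.congr_deriv ?_
        simp
      exact hg0 ((h2.congr_of_eventuallyEq hgeq).unique h1)
  refine ⟨n, hn, fun F hF hFτ hFφ hFψ => ?_⟩
  have hFc : Tendsto F (𝓝 τ) (𝓝 τ) := by simpa [hFτ] using hF.continuousAt.tendsto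
  have hφc : Tendsto φ (𝓝 τ) (𝓝 τ) := by simpa [hφτ] using hφ.continuousAt.tendsto
  have hψc : Tendsto ψ (𝓝 τ) (𝓝 τ) := by simpa [hψτ] using hψ.continuousAt.tendsto
  have hle : 𝓝[≠] τ ≤ 𝓝 τ := nhdsWithin_le_nhds
  have hne : ∀ᶠ z in 𝓝[≠] τ, z - τ ≠ 0 :=
    eventually_nhdsWithin_of_forall fun z hz => sub_ne_zero.2 hz
  have hslope : Tendsto (fun z => (F z - τ) / (z - τ)) (𝓝[≠] τ) (𝓝 (deriv F τ)) := by
    have := hasDerivAt_iff_tendsto_slope.1 hF.differentiableAt.hasDerivAt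
    refine this.congr fun z => ?_
    rw [slope_def_field, hFτ]
  have hA : Tendsto (fun z => (φ (F z) - ψ (F z)) / (z - τ) ^ n) (𝓝[≠] τ)
      (𝓝 (deriv F τ ^ n * g τ)) := by
    have hgF : Tendsto (fun z => g (F z)) (𝓝[≠] τ) (𝓝 (g τ)) :=
      hg.continuousAt.tendsto.comp (hFc.mono_left hle)
    refine ((hslope.pow n).mul hgF).congr' ?_
    filter_upwards [hle (hFc.eventually hgeq)] with z hz
    rw [Pi.sub_apply] at hz
    rw [hz, div_pow]
    ring
  have hB : Tendsto (fun z => (F (φ z) - F (ψ z)) / (z - τ) ^ n) (𝓝[≠] τ)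
      (𝓝 (deriv F τ * g τ)) := by
    -- Strict differentiability is needed: both points `φ z` and `ψ z` move.
    have hs := hF.hasStrictDerivAt.isLittleO
    have hs' := (hs.comp_tendsto ((hφc.prodMk_nhds hψc).mono_left hle))
    have hdiff : (fun z => φ z - ψ z) =ᶠ[𝓝[≠] τ] fun z => (z - τ) ^ n * g z := hle hgeq
    have hgc : Tendsto g (𝓝[≠] τ) (𝓝 (g τ)) := hg.continuousAt.tendsto.mono_left hle
    have hO : (fun z => φ z - ψ z) =O[𝓝[≠] τ] fun z => (z - τ) ^ n := by
      refine hdiff.trans_isBigO ?_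
      simpa using (Asymptotics.isBigO_refl (fun z => (z - τ) ^ n) _).mul (hgc.isBigO_one ℂ)
    have h1 := (hs'.trans_isBigO hO).tendsto_div_nhds_zero
    have h2 := h1.add (hgc.const_mul (deriv F τ))
    rw [zero_add] at h2
    refine h2.congr' ?_
    filter_upwards [hdiff, hne] with z hz hz0
    have : (z - τ) ^ n ≠ 0 := pow_ne_zero _ hz0
    simp only [Function.comp_apply, ContinuousLinearMap.toSpanSingleton_apply, smul_eq_mul]
    rw [hz]
    field_simp
    ring
  have hEq := tendsto_nhds_unique (hB.congr' ?_) hA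
  · exact (mul_right_cancel₀ hg0 hEq).symm
  · filter_upwards [hle hFφ, hle hFψ] with z h1 h2
    simp only [Function.comp_apply] at h1 h2
    rw [h1, h2]

end DiskSemigroup

/-! ### Multiplicative functions on the half-line. -/

namespace DiskSemigroup

/-- A bounded multiplicative function on `[0, ∞)` tending to `1` at `0` is an exponential. -/
theorem exists_eq_exp_of_mul {μ : ℝ → ℂ} (hb : ∀ t, 0 ≤ t → ‖μ t‖ ≤ 1)
    (hmul : ∀ t s, 0 ≤ t → 0 ≤ s → μ (t + s) = μ t * μ s) (h1 : Tendsto μ (𝓝[>] 0) (𝓝 1)) :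
    ∃ a : ℂ, ∀ t : ℝ, 0 ≤ t → μ t = Complex.exp (-a * t) := by
  have hμ0 : μ 0 = 1 := by
    have h2 : Tendsto (fun t => μ 0 * μ t) (𝓝[>] 0) (𝓝 1) := by
      refine h1.congr' ?_
      filter_upwards [self_mem_nhdsWithin] with t ht
      rw [← hmul 0 t le_rfl (le_of_lt ht), zero_add]
    simpa using tendsto_nhds_unique (h1.const_mul (μ 0)) h2
  have hcont0 : Tendsto (fun x : ℝ => μ |x|) (𝓝 0) (𝓝 1) := by
    have hIci : Tendsto μ (𝓝[≥] 0) (𝓝 1) := by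
      have : ContinuousWithinAt μ (Ioi 0) 0 := by rwa [ContinuousWithinAt, hμ0]
      simpa [ContinuousWithinAt, hμ0] using continuousWithinAt_Ioi_iff_Ici.1 this
    refine hIci.comp (tendsto_nhdsWithin_iff.2 ⟨?_, .of_forall fun x => abs_nonneg x⟩)
    simpa using (continuous_abs.tendsto (0 : ℝ))
  have hlip : ∀ x y : ℝ, 0 ≤ x → 0 ≤ y → ‖μ x - μ y‖ ≤ ‖μ |x - y| - 1‖ := by
    intro x y hx hy
    wlog hxy : y ≤ x generalizing x y
    · rw [norm_sub_rev, abs_sub_comm]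
      exact this y x hy hx (le_of_not_ge hxy)
    have h := hmul y (x - y) hy (sub_nonneg.2 hxy)
    rw [add_sub_cancel] at h
    rw [abs_of_nonneg (sub_nonneg.2 hxy), h, ← mul_sub_one, norm_mul]
    exact mul_le_of_le_one_left (norm_nonneg _) (hb y hy)
  -- The even extension is continuous on all of `ℝ`, so it can be integrated freely.
  have hν : Continuous fun x : ℝ => μ |x| := by
    refine continuous_iff_continuousAt.2 fun x₀ => ?_
    refine tendsto_iff_norm_sub_tendsto_zero.2 ?_
    have hlim : Tendsto (fun x : ℝ => ‖μ |(|x| - |x₀|)| - 1‖) (𝓝 x₀) (𝓝 0) := by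
      refine tendsto_iff_norm_sub_tendsto_zero.1 (hcont0.comp ?_)
      have : Continuous fun x : ℝ => |x| - |x₀| := by fun_prop
      simpa using this.tendsto x₀
    exact squeeze_zero (fun _ => norm_nonneg _)
      (fun x => hlip _ _ (abs_nonneg x) (abs_nonneg x₀)) hlim
  set ν : ℝ → ℂ := fun x => μ |x| with hνdef
  have hνpos : ∀ t, 0 ≤ t → ν t = μ t := fun t ht => by simp [hνdef, abs_of_nonneg ht]
  set M : ℝ → ℂ := fun t => ∫ s in (0 : ℝ)..t, ν s with hMdef
  have hM : ∀ x, HasDerivAt M (ν x) x := fun x => (hν.integral_hasStrictDerivAt 0 x).hasDerivAt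
  have hMadd : ∀ t h : ℝ, 0 ≤ t → 0 ≤ h → M (t + h) - M t = ν t * M h := by
    intro t h ht hh
    simp only [hMdef]
    rw [intervalIntegral.integral_interval_sub_left (hν.intervalIntegrable _ _)
      (hν.intervalIntegrable _ _), ← intervalIntegral.integral_const_mul]
    have := intervalIntegral.integral_comp_add_left (a := 0) (b := h) ν t
    rw [add_zero] at this
    rw [← this]
    refine intervalIntegral.integral_congr fun s hs => ?_
    rw [uIcc_of_le hh] at hs
    simp only [hνpos _ (add_nonneg ht hs.1), hνpos _ ht, hνpos _ hs.1, hmul t s ht hs.1]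
  obtain ⟨h, hMh, hh⟩ : ∃ h, M h ≠ 0 ∧ 0 < h := by
    have hne : ∀ᶠ z in 𝓝[≠] (0 : ℝ), M z ≠ 0 :=
      (hM 0).eventually_ne (by simp [hνdef, hμ0])
    have hne' : ∀ᶠ z in 𝓝[>] (0 : ℝ), M z ≠ 0 :=
      hne.filter_mono (nhdsWithin_mono _ fun x hx => ne_of_gt hx)
    obtain ⟨h, h1, h2⟩ := (hne'.and self_mem_nhdsWithin).exists
    exact ⟨h, h1, h2⟩
  -- This quotient is differentiable, which upgrades `ν` from continuous to smooth enough for the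
  -- equation `ν' = c ν`.
  have hquot : ∀ t, 0 ≤ t → (M (t + h) - M t) / M h = ν t := fun t ht => by
    rw [hMadd t h ht hh.le, mul_div_cancel_right₀ _ hMh]
  set c : ℂ := (ν h - 1) / M h with hc
  refine ⟨-c, fun t ht => ?_⟩
  set Q : ℝ → ℂ := fun x => Complex.exp (-c * x) * ((M (x + h) - M x) / M h) with hQ
  have hQd : ∀ x : ℝ, HasDerivAt Q (Complex.exp (-c * x) * (-c) * ((M (x + h) - M x) / M h) +
      Complex.exp (-c * x) * ((ν (x + h) - ν x) / M h)) x := by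
    intro x
    have e1 : HasDerivAt (fun y : ℝ => Complex.exp (-c * y)) (Complex.exp (-c * x) * (-c)) x := by
      have := ((Complex.ofRealCLM.hasDerivAt (x := x)).const_mul (-c)).cexp
      simpa using this
    exact e1.mul ((((hM (x + h)).comp_add_const x h).sub (hM x)).div_const (M h))
  have hconst := constant_of_has_deriv_right_zero (f := Q) (a := 0) (b := t)
    (fun x _ => (hQd x).continuousAt.continuousWithinAt) (fun x hx => by
      refine ((hQd x).congr_deriv ?_).hasDerivWithinAt
      rw [hquot x hx.1, hνpos _ (add_nonneg hx.1 hh.le), hmul x h hx.1 hh.le, ← hνpos x hx.1,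
        ← hνpos h hh.le, hc]
      ring) t ⟨ht, le_rfl⟩
  simp only [hQ] at hconst
  rw [hquot t ht, hquot 0 le_rfl, hνpos 0 le_rfl, hμ0, hνpos t ht] at hconst
  simp only [Complex.ofReal_zero, mul_zero, Complex.exp_zero, mul_one] at hconst
  have hexp : Complex.exp (- -c * t) * Complex.exp (-c * t) = 1 := by
    rw [← Complex.exp_add]; simp
  calc μ t = Complex.exp (- -c * t) * Complex.exp (-c * t) * μ t := by rw [hexp, one_mul]
    _ = _ := by rw [mul_assoc, hconst, mul_one]

/-! ### Fixed points and multipliers of semigroups. -/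

namespace IsSemigroup

variable {F : ℝ → ℂ → ℂ} {τ : ℂ}

theorem zero_apply (hF : IsSemigroup F) {z : ℂ} (hz : z ∈ disk) : F 0 z = z := by
  have h1 := hF.tendsto_id z hz
  have hc := ((hF.isHolSelfMap 0 le_rfl).analyticAt hz).continuousAt.tendsto.comp h1
  refine tendsto_nhds_unique hc (h1.congr' ?_)
  filter_upwards [self_mem_nhdsWithin] with t ht
  rw [Function.comp_apply, hF.comp_eq 0 t le_rfl (le_of_lt ht) z hz, zero_add]

theorem comm (hF : IsSemigroup F) {t s : ℝ} (ht : 0 ≤ t) (hs : 0 ≤ s) {z : ℂ} (hz : z ∈ disk) :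
    F t (F s z) = F s (F t z) := by
  rw [hF.comp_eq t s ht hs z hz, hF.comp_eq s t hs ht z hz, add_comm]

theorem tendsto_div_nat {t : ℝ} (ht : 0 < t) :
    Tendsto (fun n : ℕ => t / n) atTop (𝓝[>] 0) :=
  tendsto_nhdsWithin_iff.2 ⟨tendsto_const_div_atTop_nhds_zero_nat t, by
    filter_upwards [eventually_gt_atTop 0] with n hn
    have : (0 : ℝ) < n := by exact_mod_cast hn
    exact div_pos ht this⟩

/-- Telescoping: each step from `F (k * s) τ` to `F (k * s + s) τ` is the image under `F (k * s)` of
the step from `τ` to `F s τ`. -/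
theorem dist_nat_mul_le (hF : IsSemigroup F) (hτ : τ ∈ disk) {s : ℝ} (hs : 0 ≤ s)
    (hFs : F s τ ∈ Metric.ball τ (1 - ‖τ‖)) (k : ℕ) :
    dist (F (k * s) τ) τ ≤ k * (2 / (1 - ‖τ‖) * dist (F s τ) τ) := by
  induction k with
  | zero => simp [hF.zero_apply hτ]
  | succ k ih =>
    have hks : 0 ≤ (k : ℝ) * s := by positivity
    have h1 := dist_map_le (hF.isHolSelfMap _ hks) hτ hFs
    rw [hF.comp_eq _ _ hks hs τ hτ] at h1
    push_cast
    rw [add_one_mul, add_one_mul]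
    linarith [dist_triangle (F (k * s + s) τ) (F (k * s) τ) τ]

/-- A zero of the generator is a common fixed point of the semigroup. -/
theorem apply_eq_of_generator_eq_zero (hF : IsSemigroup F) {f : ℂ → ℂ} (hf : IsGenerator f F)
    (hτ : τ ∈ disk) (hfτ : f τ = 0) {t : ℝ} (ht : 0 ≤ t) : F t τ = τ := by
  rcases ht.eq_or_lt with rfl | ht
  · exact hF.zero_apply hτ
  have hs := tendsto_div_nat ht
  -- With `k = n` and `s = t / n` the telescoped bound is a constant times the difference quotient,
  -- which tends to `f τ = 0`.
  have hlim : Tendsto (fun n : ℕ => 2 / (1 - ‖τ‖) * t *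
      ‖(τ - F (t / n) τ) / ((t / n : ℝ) : ℂ)‖) atTop (𝓝 0) := by
    have := ((hf τ hτ).comp hs).norm.const_mul (2 / (1 - ‖τ‖) * t)
    rw [hfτ] at this
    simpa using this
  have hball : ∀ᶠ n : ℕ in atTop, F (t / n) τ ∈ Metric.ball τ (1 - ‖τ‖) :=
    ((hF.tendsto_id τ hτ).comp hs).eventually
      (Metric.ball_mem_nhds _ (sub_pos.2 (norm_lt_one_of_mem hτ)))
  refine dist_le_zero.1 (ge_of_tendsto hlim ?_)
  filter_upwards [hball, eventually_gt_atTop 0] with n hn hn0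
  have hn' : (0 : ℝ) < n := by exact_mod_cast hn0
  have hle := hF.dist_nat_mul_le hτ (div_pos ht hn').le hn n
  rw [mul_div_cancel₀ _ hn'.ne', dist_comm (F (t / n) τ), dist_eq_norm τ] at hle
  refine hle.trans_eq ?_
  rw [norm_div, Complex.norm_real, Real.norm_of_nonneg (div_pos ht hn').le]
  field_simp

theorem deriv_add (hF : IsSemigroup F) (hτ : τ ∈ disk) (hfix : ∀ t, 0 ≤ t → F t τ = τ)
    {t s : ℝ} (ht : 0 ≤ t) (hs : 0 ≤ s) :
    deriv (F (t + s)) τ = deriv (F t) τ * deriv (F s) τ := by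
  have h1 : HasDerivAt (F t) (deriv (F t) τ) (F s τ) := by
    rw [hfix s hs]; exact (hF.isHolSelfMap t ht).hasDerivAt hτ
  have h2 := h1.comp τ ((hF.isHolSelfMap s hs).hasDerivAt hτ)
  refine (h2.congr_of_eventuallyEq ?_).deriv
  exact eventually_of_mem (isOpen_disk.mem_nhds hτ) fun z hz => (hF.comp_eq t s ht hs z hz).symm

theorem deriv_zero (hF : IsSemigroup F) (hτ : τ ∈ disk) : deriv (F 0) τ = 1 :=
  ((hasDerivAt_id τ).congr_of_eventuallyEq
    (eventually_of_mem (isOpen_disk.mem_nhds hτ) fun _ hz => hF.zero_apply hz)).deriv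

theorem deriv_nat_mul (hF : IsSemigroup F) (hτ : τ ∈ disk) (hfix : ∀ t, 0 ≤ t → F t τ = τ)
    {s : ℝ} (hs : 0 ≤ s) (k : ℕ) : deriv (F (k * s)) τ = deriv (F s) τ ^ k := by
  induction k with
  | zero => simp [hF.deriv_zero hτ]
  | succ k ih =>
    push_cast
    rw [add_one_mul, hF.deriv_add hτ hfix (by positivity) hs, ih, pow_succ]

/-- A zero multiplier at `t` forces one at each `t / n`. The second-order Schwarz bound then
survives as `n → ∞`, giving `r ≤ r²` with `r = 1/2`. -/
theorem deriv_ne_zero (hF : IsSemigroup F) (hτ : τ ∈ disk) (hfix : ∀ t, 0 ≤ t → F t τ = τ)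
    {t : ℝ} (ht : 0 < t) : deriv (F t) τ ≠ 0 := by
  intro h0
  have h2 : (1 / 2 : ℂ) ∈ disk := by simp; norm_num
  have hz := mobius_mem_disk hτ h2
  have hlim := ((hasDerivAt_mobius hτ hz).continuousAt.tendsto.comp
    ((hF.tendsto_id _ hz).comp (tendsto_div_nat ht))).norm
  have hle : ‖mobius τ (mobius τ (1 / 2))‖ ≤ ‖mobius τ (mobius τ (1 / 2))‖ ^ 2 := by
    refine le_of_tendsto hlim ?_
    filter_upwards [eventually_gt_atTop 0] with n hn
    have hn' : (0 : ℝ) < n := by exact_mod_cast hn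
    have hs := (div_pos ht hn').le
    refine norm_mobius_le_sq_of_deriv_eq_zero (hF.isHolSelfMap _ hs) hτ (hfix _ hs) ?_ hz
    have := hF.deriv_nat_mul hτ hfix hs n
    rw [mul_div_cancel₀ _ hn'.ne', h0] at this
    exact pow_eq_zero_iff (Nat.pos_iff_ne_zero.1 hn) |>.1 this.symm
  rw [mobius_mobius hτ h2] at hle
  norm_num at hle

/-- If `|λ_1| = 1`, then `λ_t` times the multiplier at `⌈t⌉ - t` is `λ_1 ^ ⌈t⌉`, so both factors are
unimodular. -/
theorem norm_deriv_one_lt (hF : IsSemigroup F) (hτ : τ ∈ disk) (hfix : ∀ t, 0 ≤ t → F t τ = τ)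
    (hna : ¬ IsAutomorphismGroup F) : ‖deriv (F 1) τ‖ < 1 := by
  refine lt_of_le_of_ne (norm_deriv_le_one (hF.isHolSelfMap 1 zero_le_one) hτ
    (hfix 1 zero_le_one)) fun h1 => hna fun t ht => ?_
  refine isAutomorphism_of_norm_deriv_eq_one (hF.isHolSelfMap t ht) hτ (hfix t ht) ?_
  have hs : 0 ≤ (⌈t⌉₊ : ℝ) - t := sub_nonneg.2 (Nat.le_ceil t)
  have h2 := hF.deriv_add hτ hfix ht hs
  have h3 := hF.deriv_nat_mul hτ hfix zero_le_one ⌈t⌉₊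
  rw [mul_one] at h3
  rw [add_sub_cancel, h3] at h2
  have h4 : 1 = ‖deriv (F t) τ‖ * ‖deriv (F (⌈t⌉₊ - t)) τ‖ := by
    rw [← norm_mul, ← h2, norm_pow, h1, one_pow]
  have h5 := norm_deriv_le_one (hF.isHolSelfMap t ht) hτ (hfix t ht)
  have h6 := norm_deriv_le_one (hF.isHolSelfMap _ hs) hτ (hfix _ hs)
  nlinarith [norm_nonneg (deriv (F t) τ)]

theorem nat_apply_of_one_eq_id (hF : IsSemigroup F) (h : ∀ z ∈ disk, F 1 z = z) (n : ℕ) {z : ℂ}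
    (hz : z ∈ disk) : F n z = z := by
  induction n with
  | zero => simpa using hF.zero_apply hz
  | succ n ih =>
    push_cast
    rw [← hF.comp_eq n 1 n.cast_nonneg zero_le_one z hz, h z hz, ih]

theorem isAutomorphismGroup_of_one_eq_id (hF : IsSemigroup F) (h : ∀ z ∈ disk, F 1 z = z) :
    IsAutomorphismGroup F := by
  intro t ht
  have hs : 0 ≤ (⌈t⌉₊ : ℝ) - t := sub_nonneg.2 (Nat.le_ceil t)
  refine ⟨hF.isHolSelfMap t ht, F (⌈t⌉₊ - t), hF.isHolSelfMap _ hs, fun z hz => ?_, fun z hz => ?_⟩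
  · rw [hF.comp_eq _ _ hs ht z hz, sub_add_cancel, hF.nat_apply_of_one_eq_id h _ hz]
  · rw [hF.comp_eq _ _ ht hs z hz, add_sub_cancel, hF.nat_apply_of_one_eq_id h _ hz]

/-- For a semigroup that is not a group of automorphisms, an interior fixed point of the time-one
map is fixed by the whole semigroup. -/
theorem apply_eq_of_one_apply_eq (hF : IsSemigroup F) (hna : ¬ IsAutomorphismGroup F)
    (hτ : τ ∈ disk) (h1 : F 1 τ = τ) {t : ℝ} (ht : 0 ≤ t) : F t τ = τ := by
  by_contra hne
  refine hna (hF.isAutomorphismGroup_of_one_eq_id fun z hz => ?_)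
  refine eq_id_of_fixed_ne (hF.isHolSelfMap 1 zero_le_one) hτ h1
    ((hF.isHolSelfMap t ht).2 hτ) ?_ hne hz
  rw [hF.comm zero_le_one ht hτ, h1]

/-- A self-map fixing `τ` and commuting with the time-one map of a semigroup of non-automorphisms
with fixed point `τ` commutes with the whole semigroup. -/
theorem commute_of_commute_one (hF : IsSemigroup F) (hna : ¬ IsAutomorphismGroup F)
    (hτ : τ ∈ disk) (hfix : ∀ t, 0 ≤ t → F t τ = τ) {H : ℂ → ℂ} (hH : IsHolSelfMap H)
    (hHτ : H τ = τ) (hc : MapsCommute (F 1) H) {t : ℝ} (ht : 0 ≤ t) : MapsCommute (F t) H := by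
  have hF1 := hF.isHolSelfMap 1 zero_le_one
  have hFt := hF.isHolSelfMap t ht
  have hnhds := isOpen_disk.mem_nhds hτ
  have hφ := hFt.comp hH
  have hψ := hH.comp hFt
  have hd : deriv (F t ∘ H) τ = deriv (H ∘ F t) τ := by
    have h1 : HasDerivAt (F t) (deriv (F t) τ) (H τ) := by rw [hHτ]; exact hFt.hasDerivAt hτ
    have h2 : HasDerivAt H (deriv H τ) (F t τ) := by rw [hfix t ht]; exact hH.hasDerivAt hτ
    rw [(h1.comp τ (hH.hasDerivAt hτ)).deriv, (h2.comp τ (hFt.hasDerivAt hτ)).deriv, mul_comm]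
  rcases eventuallyEq_or_resonance (hφ.analyticAt hτ) (hψ.analyticAt hτ)
    (by simp [hHτ, hfix t ht]) (by simp [hHτ, hfix t ht]) hd with h | ⟨n, hn, h⟩
  · exact hφ.eqOn_of_eventuallyEq hψ hτ h
  exfalso
  have hres := h (F 1) (hF1.analyticAt hτ) (hfix 1 zero_le_one)
    (eventually_of_mem hnhds fun z hz => by
      simp only [Function.comp_apply]
      rw [hF.comm zero_le_one ht (hH.2 hz), hc z hz])
    (eventually_of_mem hnhds fun z hz => by
      simp only [Function.comp_apply]
      rw [hc _ (hFt.2 hz), hF.comm zero_le_one ht hz])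
  have hne := hF.deriv_ne_zero hτ hfix one_pos
  have hlt := hF.norm_deriv_one_lt hτ hfix hna
  have : ‖deriv (F 1) τ‖ ^ n < ‖deriv (F 1) τ‖ :=
    pow_lt_self_of_lt_one₀ (norm_pos_iff.2 hne) hlt hn
  rw [← norm_pow, hres] at this
  exact lt_irrefl _ this

end IsSemigroup

/-! ### Maps linear in the coordinate `m_τ`. -/

theorem mobius_mul_mul {τ c d z : ℂ} (hτ : τ ∈ disk) (hd : ‖d‖ ≤ 1) (hz : z ∈ disk) :
    mobius τ (c * mobius τ (mobius τ (d * mobius τ z))) = mobius τ (c * d * mobius τ z) := by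
  rw [mobius_mobius hτ (mul_mem_disk hd (mobius_mem_disk hτ hz)), mul_assoc]

theorem hasDerivAt_mobius_mul {τ : ℂ} (hτ : τ ∈ disk) (c : ℂ) :
    HasDerivAt (fun z => mobius τ (c * mobius τ z)) c τ := by
  have h1 : HasDerivAt (mobius τ) (τ * (starRingEnd ℂ) τ - 1) (c * mobius τ τ) := by
    simpa using hasDerivAt_mobius_zero hτ
  refine (h1.comp τ ((hasDerivAt_mobius_self hτ).const_mul c)).congr_deriv ?_
  have := one_sub_conj_mul_self_ne_zero hτ
  have h' : τ * (starRingEnd ℂ) τ - 1 ≠ 0 := by rwa [← neg_sub, neg_ne_zero]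
  field_simp

theorem isHolSelfMap_mobius_mul {τ c : ℂ} (hτ : τ ∈ disk) (hc : ‖c‖ ≤ 1) :
    IsHolSelfMap (fun z => mobius τ (c * mobius τ z)) :=
  (IsHolSelfMap.mobius hτ).comp ((IsHolSelfMap.mul_left hc).comp (IsHolSelfMap.mobius hτ))

section EllipticGroup

variable {F G : ℝ → ℂ → ℂ} {τ : ℂ}

/-- Two semigroups that are both linear in the coordinate `m_τ` commute. -/
theorem semigroupsCommute_of_eq_mobius_mul (hF : IsSemigroup F) (hG : IsSemigroup G)
    (hτ : τ ∈ disk) {l κ : ℝ → ℂ}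
    (hl : ∀ t, 0 ≤ t → ∀ z ∈ disk, F t z = mobius τ (l t * mobius τ z))
    (hκ : ∀ t, 0 ≤ t → ∀ z ∈ disk, G t z = mobius τ (κ t * mobius τ z)) :
    SemigroupsCommute F G := by
  -- No bound on the factors is assumed; each is a derivative at `τ`, so the Schwarz lemma supplies
  -- one.
  have key : ∀ {K : ℂ → ℂ} {c : ℂ}, IsHolSelfMap K →
      (∀ z ∈ disk, K z = mobius τ (c * mobius τ z)) → ‖c‖ ≤ 1 := by
    intro K c hK h
    have hd : HasDerivAt K c τ := (hasDerivAt_mobius_mul hτ c).congr_of_eventuallyEq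
      (eventually_of_mem (isOpen_disk.mem_nhds hτ) h)
    rw [← hd.deriv]
    exact norm_deriv_le_one hK hτ (by rw [h τ hτ]; simp)
  intro t s ht hs z hz
  have hF' := hF.isHolSelfMap t ht
  have hG' := hG.isHolSelfMap s hs
  rw [hl t ht _ (hG'.2 hz), hκ s hs _ (hF'.2 hz), hl t ht z hz, hκ s hs z hz,
    mobius_mul_mul hτ (key hG' (hκ s hs)) hz, mobius_mul_mul hτ (key hF' (hl t ht)) hz,
    mul_comm (l t)]

theorem deriv_ne_one_of_apply_ne (hF : IsSemigroup F) (hτ : τ ∈ disk)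
    (hfix : ∀ t, 0 ≤ t → F t τ = τ) {t : ℝ} (ht : 0 ≤ t) {z : ℂ} (hz : z ∈ disk)
    (hne : F t z ≠ z) : deriv (F t) τ ≠ 1 := fun h => hne <| by
  rw [eq_mobius_mul_of_norm_deriv (hF.isHolSelfMap t ht) hτ (hfix t ht) (by simp [h]) hz, h,
    one_mul, mobius_mobius hτ hz]

/-- A self-map commuting with a nontrivial group of automorphisms fixing `τ` is linear in the
coordinate `m_τ`. -/
theorem eq_mobius_mul_of_commute (hF : IsSemigroup F) (hτ : τ ∈ disk)
    (hfix : ∀ t, 0 ≤ t → F t τ = τ) (haut : IsAutomorphismGroup F) (hnt : IsNontrivial F)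
    {H : ℂ → ℂ} (hH : IsHolSelfMap H) (hHτ : H τ = τ)
    (hc : ∀ t, 0 ≤ t → MapsCommute (F t) H) {z : ℂ} (hz : z ∈ disk) :
    H z = mobius τ (deriv H τ * mobius τ z) := by
  have hlin : ∀ t, 0 ≤ t → ∀ z ∈ disk, F t z = mobius τ (deriv (F t) τ * mobius τ z) :=
    fun t ht z hz => eq_mobius_mul_of_norm_deriv (hF.isHolSelfMap t ht) hτ (hfix t ht)
      (norm_deriv_eq_one_of_isAutomorphism (haut t ht) hτ (hfix t ht)) hz
  have hH1 := norm_deriv_le_one hH hτ hHτ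
  have hψ := isHolSelfMap_mobius_mul hτ hH1
  have hnhds := isOpen_disk.mem_nhds hτ
  rcases eventuallyEq_or_resonance (hH.analyticAt hτ) (hψ.analyticAt hτ) hHτ (by simp)
    (hasDerivAt_mobius_mul hτ _).deriv.symm with h | ⟨n, hn, h⟩
  · exact hH.eqOn_of_eventuallyEq hψ hτ h hz
  exfalso
  have hres : ∀ t, 0 ≤ t → deriv (F t) τ ^ n = deriv (F t) τ := by
    intro t ht
    refine h (F t) ((hF.isHolSelfMap t ht).analyticAt hτ) (hfix t ht)
      (eventually_of_mem hnhds fun z hz => hc t ht z hz)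
      (eventually_of_mem hnhds fun z hz => ?_)
    simp only [Function.comp_apply]
    rw [hlin t ht z hz, hlin t ht _ (hψ.2 hz), mobius_mul_mul hτ hH1 hz, mobius_mul_mul hτ
      (norm_deriv_le_one (hF.isHolSelfMap t ht) hτ (hfix t ht)) hz, mul_comm (deriv H τ)]
  obtain ⟨t, ht, w, hw, hne⟩ := hnt
  refine deriv_ne_one_of_apply_ne hF hτ hfix ht hw hne ?_
  -- At `s = t / (n - 1)` resonance reads `λ_s ^ (n - 1) = 1`, and the left side is `λ_t`.
  have hn1 : n - 1 ≠ 0 := by omega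
  have hn' : ((n - 1 : ℕ) : ℝ) ≠ 0 := Nat.cast_ne_zero.2 hn1
  have hs : 0 ≤ t / (n - 1 : ℕ) := by positivity
  have h1 := hF.deriv_nat_mul hτ hfix hs (n - 1)
  rw [mul_div_cancel₀ _ hn'] at h1
  have h0 : deriv (F (t / (n - 1 : ℕ))) τ ≠ 0 := by
    rw [← norm_pos_iff, norm_deriv_eq_one_of_isAutomorphism (haut _ hs) hτ (hfix _ hs)]
    exact one_pos
  rw [h1]
  refine mul_right_cancel₀ h0 ?_
  rw [← pow_succ, Nat.sub_add_cancel (by omega), hres _ hs, one_mul]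

/-- The multiplier at `τ` of a semigroup that is linear in the coordinate `m_τ` is exponential
in time. -/
theorem exists_deriv_eq_exp (hG : IsSemigroup G) (hτ : τ ∈ disk) (hfix : ∀ t, 0 ≤ t → G t τ = τ)
    (hlin : ∀ t, 0 ≤ t → ∀ z ∈ disk, G t z = mobius τ (deriv (G t) τ * mobius τ z)) :
    ∃ a : ℂ, ∀ t : ℝ, 0 ≤ t → deriv (G t) τ = Complex.exp (-a * t) := by
  have hle : ∀ t, 0 ≤ t → ‖deriv (G t) τ‖ ≤ 1 := fun t ht =>
    norm_deriv_le_one (hG.isHolSelfMap t ht) hτ (hfix t ht)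
  refine exists_eq_exp_of_mul hle (fun t s ht hs => hG.deriv_add hτ hfix ht hs) ?_
  -- At the point with coordinate `1/2`, the multiplier is read off as a ratio of coordinates.
  have h2 : (1 / 2 : ℂ) ∈ disk := by simp; norm_num
  have hz := mobius_mem_disk hτ h2
  have hlim := ((hasDerivAt_mobius hτ hz).continuousAt.tendsto.comp
    (hG.tendsto_id _ hz)).div_const (1 / 2)
  rw [mobius_mobius hτ h2, div_self (by norm_num)] at hlim
  refine hlim.congr' ?_
  filter_upwards [self_mem_nhdsWithin] with t ht
  rw [Function.comp_apply, hlin t (le_of_lt ht) _ hz, mobius_mobius hτ h2,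
    mobius_mobius hτ (mul_mem_disk (hle t (le_of_lt ht)) h2), mul_div_cancel_right₀ _ (by norm_num)]

end EllipticGroup

end DiskSemigroup

open DiskSemigroup in
theorem theorem2 (F G : ℝ → ℂ → ℂ) (f : ℂ → ℂ) (τ : ℂ)
    (hF : DiskSemigroup.IsSemigroup F) (hG : DiskSemigroup.IsSemigroup G)
    (hf : DiskSemigroup.IsGenerator f F)
    (hcomm : DiskSemigroup.MapsCommute (F 1) (G 1))
    (hτ : τ ∈ DiskSemigroup.disk) (hfτ : f τ = 0) :
    (¬ DiskSemigroup.IsAutomorphismGroup F → ¬ DiskSemigroup.IsAutomorphismGroup G →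
      DiskSemigroup.SemigroupsCommute F G) ∧
    (DiskSemigroup.IsEllipticGroup F → DiskSemigroup.IsNontrivial F →
      (DiskSemigroup.SemigroupsCommute F G ↔
        ∃ a : ℂ, ∀ t : ℝ, 0 ≤ t → ∀ z ∈ DiskSemigroup.disk,
          G t z = DiskSemigroup.mobius τ
            (Complex.exp (-a * (t : ℂ)) * DiskSemigroup.mobius τ z))) := by
  have hfix : ∀ t, 0 ≤ t → F t τ = τ := fun t ht =>
    hF.apply_eq_of_generator_eq_zero hf hτ hfτ ht
  refine ⟨fun hFna hGna => ?_, fun hell hnt => ⟨fun hFG => ?_, ?_⟩⟩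
  · have hG1 := hG.isHolSelfMap 1 zero_le_one
    -- `F 1` fixes `G 1 τ`; were it different from `τ`, `F 1` would be the identity.
    have hG1τ : G 1 τ = τ := by
      by_contra hne
      refine hFna (hF.isAutomorphismGroup_of_one_eq_id fun z hz => ?_)
      refine eq_id_of_fixed_ne (hF.isHolSelfMap 1 zero_le_one) hτ (hfix 1 zero_le_one)
        (hG1.2 hτ) ?_ hne hz
      rw [hcomm τ hτ, hfix 1 zero_le_one]
    have hGfix : ∀ t, 0 ≤ t → G t τ = τ := fun t ht =>
      hG.apply_eq_of_one_apply_eq hGna hτ hG1τ ht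
    intro t s ht hs z hz
    -- First `H = G 1`, then the roles are swapped with `H = F t`.
    have h1 := hF.commute_of_commute_one hFna hτ hfix hG1 hG1τ hcomm ht
    exact (hG.commute_of_commute_one hGna hτ hGfix (hF.isHolSelfMap t ht) (hfix t ht)
      (fun w hw => (h1 w hw).symm) hs z hz).symm
  · have hGfix : ∀ s, 0 ≤ s → G s τ = τ := by
      intro s hs
      by_contra hne
      obtain ⟨t, ht, w, hw, hFw⟩ := hnt
      refine hFw (eq_id_of_fixed_ne (hF.isHolSelfMap t ht) hτ (hfix t ht)
        ((hG.isHolSelfMap s hs).2 hτ) ?_ hne hw)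
      rw [hFG t s ht hs τ hτ, hfix t ht]
    have hlin : ∀ s, 0 ≤ s → ∀ z ∈ disk, G s z = mobius τ (deriv (G s) τ * mobius τ z) :=
      fun s hs z hz => eq_mobius_mul_of_commute hF hτ hfix hell.1 hnt (hG.isHolSelfMap s hs)
        (hGfix s hs) (fun t ht => hFG t s ht hs) hz
    obtain ⟨a, ha⟩ := exists_deriv_eq_exp hG hτ hGfix hlin
    exact ⟨a, fun t ht z hz => by rw [← ha t ht]; exact hlin t ht z hz⟩
  · rintro ⟨a, ha⟩
    exact semigroupsCommute_of_eq_mobius_mul hF hG hτ (l := fun t => deriv (F t) τ)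
      (κ := fun t => Complex.exp (-a * (t : ℂ)))
      (fun t ht z hz => eq_mobius_mul_of_norm_deriv (hF.isHolSelfMap t ht) hτ (hfix t ht)
        (norm_deriv_eq_one_of_isAutomorphism (hell.1 t ht) hτ (hfix t ht)) hz) ha
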